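/- Let $\mathsf{O}\subseteq\mathbb{R}^d$ carry the trace Borel $\sigma$-algebra, let $\mathsf{A}\subseteq\mathbb{R}^k$, and let $\mathcal{F}$ be a convex class of Borel probability measures on $\mathsf{O}$. For a function $g$ on $\mathsf{A}\times\mathsf{O}$ write $\bar g(x,F)=\int_{\mathsf{O}} g(x,y)\,\mathrm{d}F(y)$; a function on $\mathsf{O}$ is called $\mathcal{F}$-integrable if it is $F$-integrable for every $F\in\mathcal{F}$. "Locally" means "on every compact subset of the domain". Assume that $\operatorname{int}(\mathsf{A})$ is a hyperrectangle (a product of $k$ intervals, possibly unbounded), and let $T:\mathcal{F}\to\mathsf{A}$ be surjective. Let $S:\mathsf{A}\times\mathsf{O}\to\mathbb{R}$ be a strictly $\mathcal{F}$-consistent scoring function for $T$: $S(x,\cdot)$ is $\mathcal{F}$-integrable for all $x\in\mathsf{A}$, and $\bar S(x,F)\ge\bar S(T(F),F)$ for all $x\in\mathsf{A}$, $F\in\mathcal{F}$, with equality only if $x=T(F)$. Let $V:\mathsf{A}\times\mathsf{O}\to\mathbb{R}^k$ be a Borel measurable strict $\mathcal{F}$-identification function for $T$: $V(x,\cdot)$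 is $\mathcal{F}$-integrable for all $x\in\mathsf{A}$, and $\bar V(x,F)=0$ if and only if $x=T(F)$. Suppose: - (V1) for every $x\in\operatorname{int}(\mathsf{A})$ there are $F_1,\dots,F_{k+1}\in\mathcal{F}$ with $0\in\operatorname{int}(\operatorname{conv}\{\bar V(x,F_1),\dots,\bar V(x,F_{k+1})\})$; - (V2) $\bar V(\cdot,F)$ is continuous on $\mathsf{A}$ for every $F\in\mathcal{F}$; - (S1) $\bar S(\cdot,F)$ is continuously differentiable on $\operatorname{int}(\mathsf{A})$ for every $F\in\mathcal{F}$; - (F1) for every $y\in\mathsf{O}$ there are a compact set $K\subseteq\mathsf{O}$ and a sequence $(F_n)$ in $\mathcal{F}$, all $F_n$ supported in $K$, that converges weakly to $\delta_y$; - (VS1) the set of all $(x,y)\in\mathsf{A}\times\mathsf{O}$ such that $V(x,\cdot)$ or $S(x,\cdot)$ is not continuous at $y$ has $(k+d)$-dimensional Lebesgue measure zero; - (B1) $V$ is locally bounded on $\mathsf{A}\times\mathsf{O}$; - for all $x\in\mathsf{A}$ the functions $V(x,\cdot)$ and $S(x,\cdot)$ are locally bounded, and for all $y\in\mathsf{O}$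 the function $V(\cdot,y)$ is locally Lebesgue integrable. Then there is a unique function $h:\operatorname{int}(\mathsf{A})\to\mathbb{R}^{k\times k}$ with $$\partial_l\bar S(x,F)=\sum_{m=1}^k h_{lm}(x)\,\bar V_m(x,F)\qquad\text{for all } x\in\operatorname{int}(\mathsf{A}),\ F\in\mathcal{F},\ l\in\{1,\dots,k\},$$ and $h$ is continuous. For Lebesgue-almost every $z\in\operatorname{int}(\mathsf{A})$ there is an $\mathcal{F}$-integrable function $a:\mathsf{O}\to\mathbb{R}$ such that for Lebesgue-almost all $(x,y)\in\operatorname{int}(\mathsf{A})\times\mathsf{O}$ $$S(x,y)=\sum_{r=1}^k\sum_{m=1}^k\int_{z_r}^{x_r}h_{rm}(x_1,\dots,x_{r-1},v,z_{r+1},\dots,z_k)\,V_m(x_1,\dots,x_{r-1},v,z_{r+1},\dots,z_k,y)\,\mathrm{d}v+a(y),$$ and, on the level of the expected score, for all $x\in\operatorname{int}(\mathsf{A})$ and all $F\in\mathcal{F}$ $$\bar S(x,F)=\sum_{r=1}^k\sum_{m=1}^k\int_{z_r}^{x_r}h_{rm}(x_1,\dots,x_{r-1},v,z_{r+1},\dots,z_k)\,\bar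 V_m(x_1,\dots,x_{r-1},v,z_{r+1},\dots,z_k,F)\,\mathrm{d}v+\int_{\mathsf{O}}a\,\mathrm{d}F.$$ All line integrals over $v$ above exist, for all $x,z\in\operatorname{int}(\mathsf{A})$, $y\in\mathsf{O}$ and $F\in\mathcal{F}$. -/

import Mathlib

open MeasureTheory Set Filter Topology
open scoped NNReal

namespace Osband

/-- `ℝⁿ` with its Euclidean structure. -/
abbrev E (n : ℕ) : Type := EuclideanSpace ℝ (Fin n)

/-! Conventions.  `A ⊆ ℝᵏ` is the action domain and `O ⊆ ℝᵈ` the observation domain, with the trace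
of the Borel σ-algebra.  A distribution on `O` is a `ProbabilityMeasure O`.  A function on `A × O` is
written as a function `ℝᵏ → O → _` of which only the values at points `x ∈ A` are ever used; likewise
only the values of `T : ProbabilityMeasure O → ℝᵏ` on the class `𝓕` are used. -/

/-- The expectation `ḡ(x, P) = ∫ g(x, y) dP(y)`. -/
noncomputable def bar {k d : ℕ} {O : Set (E d)} {G : Type*} [NormedAddCommGroup G]
    [NormedSpace ℝ G] (g : E k → O → G) (x : E k) (P : ProbabilityMeasure O) : G :=
  ∫ y, g x y ∂(P : Measure O)

/-- `𝓕`-integrability of a function on `O`. -/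
def ClassIntegrable {d : ℕ} {O : Set (E d)} (𝓕 : Set (ProbabilityMeasure O))
    {G : Type*} [NormedAddCommGroup G] (a : O → G) : Prop :=
  ∀ P ∈ 𝓕, Integrable a (P : Measure O)

/-- `S` is a strictly `𝓕`-consistent scoring function for `T : 𝓕 → A`. -/
def IsStrictlyConsistent {k d : ℕ} (A : Set (E k)) {O : Set (E d)}
    (𝓕 : Set (ProbabilityMeasure O)) (T : ProbabilityMeasure O → E k) (S : E k → O → ℝ) : Prop :=
  (∀ x ∈ A, ClassIntegrable 𝓕 (S x)) ∧
  (∀ x ∈ A, ∀ P ∈ 𝓕, bar S (T P) P ≤ bar S x P) ∧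
  (∀ x ∈ A, ∀ P ∈ 𝓕, bar S x P = bar S (T P) P → x = T P)

/-- `V` is a strict `𝓕`-identification function for `T : 𝓕 → A`.  As a function on `A × O` it is
taken to be (jointly) Borel measurable. -/
def IsStrictIdentification {k d : ℕ} (A : Set (E k)) {O : Set (E d)}
    (𝓕 : Set (ProbabilityMeasure O)) (T : ProbabilityMeasure O → E k) (V : E k → O → E k) : Prop :=
  Measurable (fun p : A × O => V p.1 p.2) ∧
  (∀ x ∈ A, ClassIntegrable 𝓕 (V x)) ∧
  (∀ x ∈ A, ∀ P ∈ 𝓕, bar V x P = 0 ↔ x = T P)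

/-- A function on a topological space is locally bounded if it is bounded on all compact sets. -/
def LocallyBdd {X G : Type*} [TopologicalSpace X] [NormedAddCommGroup G] (f : X → G) : Prop :=
  ∀ K : Set X, IsCompact K → ∃ M : ℝ, ∀ x ∈ K, ‖f x‖ ≤ M

/-- The standing local regularity assumption: `V(x, ·)` and `S(x, ·)` are locally bounded, and
`V(·, y)` is Lebesgue integrable on the compact subsets of `A`. -/
def LocalRegularity {k d : ℕ} (A : Set (E k)) {O : Set (E d)}
    (V : E k → O → E k) (S : E k → O → ℝ) : Prop :=
  (∀ x ∈ A, LocallyBdd (V x) ∧ LocallyBdd (S x)) ∧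
  (∀ y : O, ∀ K : Set (E k), K ⊆ A → IsCompact K → IntegrableOn (fun x => V x y) K volume)

/-- (V1) -/
def CondV1 {k d : ℕ} (A : Set (E k)) {O : Set (E d)}
    (𝓕 : Set (ProbabilityMeasure O)) (V : E k → O → E k) : Prop :=
  ∀ x ∈ interior A, ∃ P : Fin (k + 1) → ProbabilityMeasure O, (∀ i, P i ∈ 𝓕) ∧
    (0 : E k) ∈ interior (convexHull ℝ (range fun i => bar V x (P i)))

/-- (V2) -/
def CondV2 {k d : ℕ} (A : Set (E k)) {O : Set (E d)}
    (𝓕 : Set (ProbabilityMeasure O)) (V : E k → O → E k) : Prop :=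
  ∀ P ∈ 𝓕, ContinuousOn (fun x => bar V x P) A

/-- (S1); continuous differentiability of a function on `A` refers to the interior of `A`. -/
def CondS1 {k d : ℕ} (A : Set (E k)) {O : Set (E d)}
    (𝓕 : Set (ProbabilityMeasure O)) (S : E k → O → ℝ) : Prop :=
  ∀ P ∈ 𝓕, ContDiffOn ℝ 1 (fun x => bar S x P) (interior A)

/-- (F1): each Dirac measure is a weak limit of members of `𝓕` carried by one compact set. -/
def CondF1 {d : ℕ} {O : Set (E d)} (𝓕 : Set (ProbabilityMeasure O)) : Prop :=
  ∀ y : O, ∃ (P : ℕ → ProbabilityMeasure O) (K : Set O), (∀ n, P n ∈ 𝓕) ∧ IsCompact K ∧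
    (∀ n, (P n : Measure O) Kᶜ = 0) ∧
    Tendsto P atTop (𝓝 (⟨Measure.dirac y, inferInstance⟩ : ProbabilityMeasure O))

/-- (VS1): the pairs `(x, y) ∈ A × O` at which `V(x, ·)` or `S(x, ·)` is not continuous at `y` form a
set of `(k + d)`-dimensional Lebesgue measure zero. -/
def CondVS1 {k d : ℕ} (A : Set (E k)) {O : Set (E d)}
    (V : E k → O → E k) (S : E k → O → ℝ) : Prop :=
  volume {p : E k × E d | p.1 ∈ A ∧ ∃ hy : p.2 ∈ O,
    ¬ (ContinuousAt (V p.1) ⟨p.2, hy⟩ ∧ ContinuousAt (S p.1) ⟨p.2, hy⟩)} = 0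

/-- (B1): `V` is locally bounded on `A × O`. -/
def CondB1 {k d : ℕ} (A : Set (E k)) {O : Set (E d)} (V : E k → O → E k) : Prop :=
  LocallyBdd (fun p : A × O => V p.1 p.2)

/-- A hyperrectangle: a product of intervals, which may be unbounded. -/
def IsHyperrectangle {k : ℕ} (B : Set (E k)) : Prop :=
  ∃ I : Fin k → Set ℝ, (∀ i, (I i).OrdConnected) ∧ B = {x | ∀ i, x i ∈ I i}

/-- The point `(x₁, …, x_{r-1}, v, z_{r+1}, …, z_k)`. -/
noncomputable def pathPoint {k : ℕ} (x z : E k) (r : Fin k) (v : ℝ) : E k :=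
  WithLp.toLp 2 fun i => if i < r then x i else if i = r then v else z i

/-- The relation `∂ₗ S̄(x, P) = ∑ₘ hₗₘ(x) V̄ₘ(x, P)` on `int A` and `𝓕`, including the existence of the
partial derivatives. -/
def OsbandRelation {k d : ℕ} (A : Set (E k)) {O : Set (E d)}
    (𝓕 : Set (ProbabilityMeasure O)) (V : E k → O → E k) (S : E k → O → ℝ)
    (h : E k → Matrix (Fin k) (Fin k) ℝ) : Prop :=
  ∀ x ∈ interior A, ∀ P ∈ 𝓕, ∀ l : Fin k,
    HasLineDerivAt ℝ (fun x' => bar S x' P) (∑ m, h x l m * bar V x P m) x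
      (EuclideanSpace.single l 1)

end Osband

/-! At an interior point `x`, consider the pairs (V̄(x,P), ∇S̄(x,P)) for P in the class. They form a
convex set, since both entries respect mixtures. If V̄(x,P) = 0, then `x = T P` minimises S̄(·,P),
so the gradient vanishes; by (V1) the first entries fill a neighbourhood of 0. Such a set lies in
the graph of a linear map (`exists_linearMap_of_convex`), whose matrix is h(x). Choosing k
distributions with linearly independent V̄(x,P) recovers h by inverting a matrix, which gives
uniqueness and continuity.

Integrating the gradient along an axis-parallel path yields the expected formula with a = S(z,·)
(`OsbandRelation.bar_eq`). For the pointwise formula, apply it to the distributions of (F1)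
converging to the Dirac measure at y and pass to the limit (`OsbandRelation.score_eq`). This needs
continuity at y of S(x,·), of S(z,·), and of V(u,·) for almost every u on the path; by Fubini and
`ae_pathPoint_notMem`, (VS1) provides it for almost all z and (x,y). -/

namespace Osband

/-! ### Convex sets and linear graphs -/

/-- A convex set over a neighbourhood of `0` that meets the fibre over `0` at most in `0` lies in the
graph of a linear map. -/
lemma exists_linearMap_of_convex {X Y : Type*} [NormedAddCommGroup X] [NormedSpace ℝ X]
    [AddCommGroup Y] [Module ℝ Y] {C : Set (X × Y)} (hC : Convex ℝ C)
    (h0 : ∀ s, ((0 : X), s) ∈ C → s = 0) (hint : (0 : X) ∈ interior (Prod.fst '' C)) :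
    ∃ f : X →ₗ[ℝ] Y, ∀ p ∈ C, f p.1 = p.2 := by
  have hzero : (0 : X × Y) ∈ C := by
    obtain ⟨⟨u, s⟩, hp, rfl⟩ := interior_subset hint
    have := h0 s hp
    subst this
    exact hp
  have hray : ∀ v : X, ∃ ε : ℝ, 0 < ε ∧ ε • v ∈ Prod.fst '' C := by
    intro v
    have hcont : Tendsto (fun t : ℝ => t • v) (𝓝[>] 0) (𝓝 0) := by
      have : Continuous fun t : ℝ => t • v := by fun_prop
      simpa using (this.tendsto 0).mono_left nhdsWithin_le_nhds
    have h1 := hcont.eventually (mem_interior_iff_mem_nhds.1 hint)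
    obtain ⟨ε, h2, h3⟩ := (h1.and self_mem_nhdsWithin).exists
    exact ⟨ε, h3, h2⟩
  -- Pair `p` with a point of `C` over a negative multiple of its first coordinate. The weights
  -- below cancel the first coordinates, so the combination lies over 0 and hence is 0: the second
  -- point is a negative multiple of `p`.
  have hneg : ∀ p ∈ C, ∃ ε : ℝ, 0 < ε ∧ (-ε) • p ∈ C := by
    rintro ⟨v, s⟩ hp
    obtain ⟨ε, hε, ⟨⟨u, t⟩, hu, huv⟩⟩ := hray (-v)
    simp only at huv
    subst huv
    have hmem := hC hp hu (a := ε / (1 + ε)) (b := 1 / (1 + ε)) (by positivity) (by positivity)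
      (by field_simp; ring)
    have hfst : (ε / (1 + ε)) • (v, s) + (1 / (1 + ε)) • (ε • -v, t) =
        ((0 : X), (ε / (1 + ε)) • s + (1 / (1 + ε)) • t) := by
      ext1
      · simp only [Prod.fst_add, Prod.smul_fst, smul_neg, smul_smul]
        rw [show 1 / (1 + ε) * ε = ε / (1 + ε) by ring]
        simp
      · simp
    rw [hfst] at hmem
    have hz := h0 _ hmem
    have ht : t = (-ε) • s := by
      have := congrArg (fun w => (1 + ε) • w) hz
      simp only [smul_add, smul_smul, smul_zero] at this
      rw [show (1 + ε) * (ε / (1 + ε)) = ε by field_simp,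
        show (1 + ε) * (1 / (1 + ε)) = 1 by field_simp, one_smul] at this
      rw [neg_smul]
      exact eq_neg_of_add_eq_zero_right this
    refine ⟨ε, hε, ?_⟩
    rw [ht] at hu
    simpa using hu
  -- By `hneg`, the cone over `C` is already a subspace. The fibre condition `h0` thus passes from
  -- `C` to its span and makes the projection injective there.
  have hspan : ∀ w ∈ Submodule.span ℝ C, ∃ c : ℝ, 0 < c ∧ ∃ p ∈ C, w = c • p := by
    intro w hw
    induction hw using Submodule.span_induction with
    | mem x h => exact ⟨1, one_pos, x, h, (one_smul _ _).symm⟩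
    | zero => exact ⟨1, one_pos, 0, hzero, by simp⟩
    | add x y _ _ hx hy =>
      obtain ⟨c, hc, p, hp, rfl⟩ := hx
      obtain ⟨c', hc', p', hp', rfl⟩ := hy
      refine ⟨c + c', by positivity, (c / (c + c')) • p + (c' / (c + c')) • p',
        hC hp hp' (by positivity) (by positivity) (by field_simp), ?_⟩
      rw [smul_add, smul_smul, smul_smul, mul_div_cancel₀ _ (by positivity),
        mul_div_cancel₀ _ (by positivity)]
    | smul a x _ hx =>
      obtain ⟨c, hc, p, hp, rfl⟩ := hx
      rcases lt_trichotomy a 0 with ha | rfl | ha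
      · obtain ⟨ε, hε, hm⟩ := hneg p hp
        refine ⟨-a * c / ε, by have := neg_pos.2 ha; positivity, _, hm, ?_⟩
        rw [smul_smul, smul_smul]
        congr 1
        field_simp
      · exact ⟨1, one_pos, 0, hzero, by simp⟩
      · exact ⟨a * c, by positivity, p, hp, smul_smul _ _ _⟩
  let W := Submodule.span ℝ C
  let π : W →ₗ[ℝ] X := (LinearMap.fst ℝ X Y).comp W.subtype
  have hinj : Function.Injective π := by
    rw [← LinearMap.ker_eq_bot, LinearMap.ker_eq_bot']
    rintro ⟨w, hw⟩ hπ
    obtain ⟨c, hc, ⟨u, s⟩, hp, rfl⟩ := hspan w hw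
    have hu : c • u = 0 := hπ
    have hu' : u = 0 := (smul_eq_zero.1 hu).resolve_left hc.ne'
    subst hu'
    have := h0 s hp
    subst this
    ext1
    simp
  have hsurj : Function.Surjective π := by
    intro v
    obtain ⟨ε, hε, p, hp, hpv⟩ := hray v
    refine ⟨⟨ε⁻¹ • p, W.smul_mem _ (Submodule.subset_span hp)⟩, ?_⟩
    simp [π, hpv, smul_smul, hε.ne']
  let e := LinearEquiv.ofBijective π ⟨hinj, hsurj⟩
  refine ⟨((LinearMap.snd ℝ X Y).comp W.subtype).comp e.symm.toLinearMap, fun p hp => ?_⟩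
  have : e.symm p.1 = ⟨p, Submodule.subset_span hp⟩ := by
    rw [LinearEquiv.symm_apply_eq]
    rfl
  simp [this]

/-! ### Weak convergence to a Dirac measure -/

/-- Integrals of a function which is bounded on a common carrier and continuous at `y` converge along
weak convergence to the Dirac measure at `y`. -/
lemma tendsto_integral_of_tendsto_dirac {X G : Type*} [TopologicalSpace X] [MeasurableSpace X]
    [OpensMeasurableSpace X] [HasOuterApproxClosed X] [NormedAddCommGroup G] [NormedSpace ℝ G]
    [CompleteSpace G] {y : X} {P : ℕ → ProbabilityMeasure X}
    (hP : Tendsto P atTop (𝓝 (⟨Measure.dirac y, inferInstance⟩ : ProbabilityMeasure X)))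
    {K : Set X} (hK : ∀ n, (P n : Measure X) Kᶜ = 0) {g : X → G} (hg : ContinuousAt g y)
    (hint : ∀ n, Integrable g (P n : Measure X)) {M : ℝ} (hM : ∀ x ∈ K, ‖g x‖ ≤ M) :
    Tendsto (fun n => ∫ x, g x ∂(P n : Measure X)) atTop (𝓝 (g y)) := by
  rw [Metric.tendsto_nhds]
  intro ε hε
  -- Continuity is available only at `y`: `g` is close to `g y` on an open `U`, while the closed
  -- complement has mass tending to 0 by the portmanteau theorem and `g` is bounded on the carrier.
  obtain ⟨U, hUsub, hUo, hyU⟩ := mem_nhds_iff.1 (hg (Metric.closedBall_mem_nhds (g y) (half_pos hε)))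
  set C : ℝ := |M| + ‖g y‖
  have hlim : Tendsto (fun n => (P n : Measure X) Uᶜ) atTop (𝓝 0) := by
    have h1 := ProbabilityMeasure.limsup_measure_closed_le_of_tendsto hP hUo.isClosed_compl
    have h2 : ((⟨Measure.dirac y, inferInstance⟩ : ProbabilityMeasure X) : Measure X) Uᶜ = 0 := by
      change Measure.dirac y Uᶜ = 0
      rw [Measure.dirac_apply' _ hUo.measurableSet.compl]
      simp [hyU]
    exact tendsto_of_le_liminf_of_limsup_le bot_le (h1.trans h2.le)
  have hlim' : Tendsto (fun n => C * (P n : Measure X).real Uᶜ) atTop (𝓝 0) := by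
    have h3 := (ENNReal.tendsto_toReal ENNReal.zero_ne_top).comp hlim
    have h4 := h3.const_mul C
    rwa [ENNReal.toReal_zero, mul_zero] at h4
  filter_upwards [hlim'.eventually (gt_mem_nhds (half_pos hε))] with n hn
  have hC : ∀ᵐ x ∂(P n : Measure X), ‖g x - g y‖ ≤ ε / 2 + C * Uᶜ.indicator 1 x := by
    have hKae : ∀ᵐ x ∂(P n : Measure X), x ∈ K := by
      rw [ae_iff]
      exact hK n
    filter_upwards [hKae] with x hx
    by_cases hxU : x ∈ U
    · have : dist (g x) (g y) ≤ ε / 2 := hUsub hxU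
      rw [dist_eq_norm] at this
      simpa [hxU] using this
    · have h1 := norm_sub_le (g x) (g y)
      have h2 := (hM x hx).trans (le_abs_self M)
      simp only [mem_compl_iff, hxU, not_false_eq_true, indicator_of_mem, Pi.one_apply, mul_one, C]
      linarith
  have hind : Integrable (fun x => ε / 2 + C * Uᶜ.indicator (1 : X → ℝ) x) (P n : Measure X) :=
    (integrable_const _).add
      (((integrable_const (1 : ℝ)).indicator hUo.measurableSet.compl).const_mul C)
  have hsub : ∫ x, g x ∂(P n : Measure X) - g y = ∫ x, (g x - g y) ∂(P n : Measure X) := by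
    rw [integral_sub (hint n) (integrable_const _)]
    simp
  rw [dist_eq_norm, hsub]
  calc ‖∫ x, (g x - g y) ∂(P n : Measure X)‖
      ≤ ∫ x, (ε / 2 + C * Uᶜ.indicator (1 : X → ℝ) x) ∂(P n : Measure X) :=
        norm_integral_le_of_norm_le hind hC
    _ = ε / 2 + C * (P n : Measure X).real Uᶜ := by
        rw [integral_add (f := fun _ => ε / 2) (g := fun x => C * Uᶜ.indicator (1 : X → ℝ) x)
          (integrable_const _) (((integrable_const (1 : ℝ)).indicator hUo.measurableSet.compl).const_mul C),
          integral_const_mul, integral_indicator_one hUo.measurableSet.compl]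
        simp
    _ < ε := by linarith

/-! ### Axis-parallel paths -/

section pathPoint

variable {k : ℕ}

@[simp] lemma pathPoint_apply (x z : E k) (r : Fin k) (v : ℝ) (i : Fin k) :
    pathPoint x z r v i = if i < r then x i else if i = r then v else z i := rfl

lemma pathPoint_add (x z : E k) (r : Fin k) (v t : ℝ) :
    pathPoint x z r v + t • EuclideanSpace.single r 1 = pathPoint x z r (v + t) := by
  ext i
  by_cases h : i = r
  · subst h; simp
  · simp [h]

lemma continuous_pathPoint (x z : E k) (r : Fin k) : Continuous (pathPoint x z r) := by
  have : pathPoint x z r = fun v => pathPoint x z r 0 + v • EuclideanSpace.single r 1 := by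
    funext v
    rw [pathPoint_add, zero_add]
  rw [this]
  fun_prop

/-- The shape of `int A` enters through this lemma alone; convexity would not keep an axis-parallel
path inside. -/
lemma IsHyperrectangle.pathPoint_mem {B : Set (E k)} (hB : IsHyperrectangle B) {x z : E k}
    (hx : x ∈ B) (hz : z ∈ B) (r : Fin k) {v : ℝ} (hv : v ∈ uIcc (z r) (x r)) :
    pathPoint x z r v ∈ B := by
  obtain ⟨I, hI, rfl⟩ := hB
  intro i
  rw [pathPoint_apply]
  split_ifs with h1 h2
  · exact hx i
  · subst h2
    exact (hI i).uIcc_subset (hz i) (hx i) hv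
  · exact hz i

/-- The fundamental theorem of calculus along the axis-parallel path from `z` to `x`. -/
lemma sub_eq_sum_integral_pathPoint {f : E k → ℝ} {g : Fin k → E k → ℝ} {x z : E k}
    (hf : ∀ r, ∀ v ∈ uIcc (z r) (x r), HasLineDerivAt ℝ f (g r (pathPoint x z r v))
      (pathPoint x z r v) (EuclideanSpace.single r 1))
    (hg : ∀ r, IntervalIntegrable (fun v => g r (pathPoint x z r v)) volume (z r) (x r)) :
    f x - f z = ∑ r : Fin k, ∫ v in (z r)..(x r), g r (pathPoint x z r v) := by
  -- The corners of the path: the first `j` coordinates are already those of `x`. The leg in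
  -- direction `r` joins `w r` to `w (r + 1)`, so the sum telescopes.
  let w : ℕ → E k := fun j => WithLp.toLp 2 fun i => if (i : ℕ) < j then x i else z i
  have hsum : ∀ r : Fin k, ∫ v in (z r)..(x r), g r (pathPoint x z r v) =
      f (w (r + 1)) - f (w r) := by
    intro r
    have hd : ∀ v ∈ uIcc (z r) (x r), HasDerivAt (fun s => f (pathPoint x z r s))
        (g r (pathPoint x z r v)) v := by
      intro v hv
      have h1 : HasDerivAt (fun t => f (pathPoint x z r v + t • EuclideanSpace.single r 1))
        (g r (pathPoint x z r v)) (v - v) := by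
        rw [sub_self]; exact hf r v hv
      have h2 := HasDerivAt.comp_sub_const v v h1
      simpa only [pathPoint_add, add_sub_cancel] using h2
    rw [intervalIntegral.integral_eq_sub_of_hasDerivAt hd (hg r)]
    congr 2
    · ext i
      rw [pathPoint_apply]
      simp only [w]
      rcases lt_trichotomy i r with h | rfl | h
      · have : (i : ℕ) < r + 1 := by omega
        simp [h, this]
      · simp
      · have : ¬ (i : ℕ) < r + 1 := by omega
        simp [h.not_gt, h.ne', this]
    · ext i
      rw [pathPoint_apply]
      simp only [w]
      rcases lt_trichotomy i r with h | rfl | h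
      · simp [h]
      · simp
      · simp [h.not_gt, h.ne']
  rw [Finset.sum_congr rfl fun r _ => hsum r,
    ← Finset.sum_range (fun j => f (w (j + 1)) - f (w j)), Finset.sum_range_sub (fun j => f (w j))]
  congr 2
  ext i
  simp [w]

/-- A null set of pairs is avoided, for almost all end points, almost everywhere on the path. -/
lemma ae_pathPoint_notMem {d : ℕ} {N : Set (E k × E d)} (hN : volume N = 0) :
    ∀ᵐ z : E k, ∀ᵐ p : E k × E d, ∀ r : Fin k, ∀ᵐ v : ℝ, (pathPoint p.1 z r v, p.2) ∉ N := by
  have key : ∀ r : Fin k, ∀ᵐ z : E k, ∀ᵐ p : E k × E d, ∀ᵐ v : ℝ,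
      (pathPoint p.1 z r v, p.2) ∉ N := by
    intro r
    -- The path point is jointly linear in `z`, `(x, y)` and `v`. Preimages of null sets under a
    -- surjective linear map are null, and Fubini then separates the variables.
    let L : (E k × (E k × E d) × ℝ) →ₗ[ℝ] E k × E d :=
      { toFun := fun q => (pathPoint q.2.1.1 q.1 r q.2.2, q.2.1.2)
        map_add' := by
          intro a b
          ext i
          · simp only [Prod.fst_add, Prod.snd_add, PiLp.add_apply, pathPoint_apply]
            split_ifs <;> rfl
          · rfl
        map_smul' := by
          intro c a
          ext i
          · simp only [Prod.smul_fst, Prod.smul_snd, PiLp.smul_apply, pathPoint_apply,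
              RingHom.id_apply]
            split_ifs <;> rfl
          · rfl }
    have hL : Function.Surjective L := by
      rintro ⟨x, y⟩
      refine ⟨(x, (x, y), x r), ?_⟩
      ext i
      · change pathPoint x x r (x r) i = x i
        rw [pathPoint_apply]
        split_ifs with h1 h2
        · rfl
        · rw [h2]
        · rfl
      · rfl
    have hN' : ∀ᵐ q : E k × E d, q ∈ (toMeasurable volume N)ᶜ := by
      rw [ae_iff]
      simpa using hN
    have i1 : Measure.IsAddHaarMeasure (volume : Measure (E k × E d)) :=
      Measure.prod.instIsAddHaarMeasure _ _
    have i2 : Measure.IsAddHaarMeasure (volume : Measure ((E k × E d) × ℝ)) :=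
      Measure.prod.instIsAddHaarMeasure _ _
    have i3 : Measure.IsAddHaarMeasure (volume : Measure (E k × (E k × E d) × ℝ)) :=
      Measure.prod.instIsAddHaarMeasure _ _
    have h1 := (ae_comp_linearMap_mem_iff L
      (volume : Measure (E k × (E k × E d) × ℝ)) (volume : Measure (E k × E d)) hL
      (measurableSet_toMeasurable _ _).compl).2 hN'
    filter_upwards [Measure.ae_ae_of_ae_prod h1] with z hz
    filter_upwards [Measure.ae_ae_of_ae_prod hz] with p hp
    filter_upwards [hp] with v hv
    exact fun hmem => hv (subset_toMeasurable _ _ hmem)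
  filter_upwards [ae_all_iff.2 key] with z hz
  exact ae_all_iff.2 hz

end pathPoint

variable {k d : ℕ} {A : Set (E k)} {O : Set (E d)} {𝓕 : Set (ProbabilityMeasure O)}
  {T : ProbabilityMeasure O → E k} {V : E k → O → E k} {S : E k → O → ℝ}
  {h : E k → Matrix (Fin k) (Fin k) ℝ}

/-! ### The matrix `h`: existence, uniqueness, continuity -/

lemma continuous_coord (m : Fin k) : Continuous fun u : E k => u m := by fun_prop

lemma bar_eq_of_mixture {G : Type*} [NormedAddCommGroup G] [NormedSpace ℝ G] {g : E k → O → G}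
    {x : E k} (hg : ClassIntegrable 𝓕 (g x)) {P Q R : ProbabilityMeasure O} (hP : P ∈ 𝓕)
    (hQ : Q ∈ 𝓕) {a b : ℝ≥0} (hR : (R : Measure O) = a • (P : Measure O) + b • (Q : Measure O)) :
    bar g x R = (a : ℝ) • bar g x P + (b : ℝ) • bar g x Q := by
  unfold bar
  rw [hR, integral_add_measure ((hg P hP).smul_measure_nnreal) ((hg Q hQ).smul_measure_nnreal),
    integral_smul_nnreal_measure, integral_smul_nnreal_measure]
  rfl

lemma differentiableAt_bar (hS1 : CondS1 A 𝓕 S) {x : E k} (hx : x ∈ interior A)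
    {P : ProbabilityMeasure O} (hP : P ∈ 𝓕) :
    DifferentiableAt ℝ (fun x' => bar S x' P) x :=
  ((hS1 P hP).differentiableOn one_ne_zero x hx).differentiableAt
    (isOpen_interior.mem_nhds hx)

/-- At an interior point, the gradient of the expected score depends linearly on the expected
identification function. -/
lemma exists_linearMap_bar_eq_fderiv
    (h𝓕 : Convex ℝ≥0 ((fun P : ProbabilityMeasure O => (P : Measure O)) '' 𝓕))
    (hV : IsStrictIdentification A 𝓕 T V) (hS : IsStrictlyConsistent A 𝓕 T S)
    (hV1 : CondV1 A 𝓕 V) (hS1 : CondS1 A 𝓕 S) {x : E k} (hx : x ∈ interior A) :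
    ∃ f : E k →ₗ[ℝ] (E k →L[ℝ] ℝ),
      ∀ P ∈ 𝓕, f (bar V x P) = fderiv ℝ (fun x' => bar S x' P) x := by
  let Φ : ProbabilityMeasure O → E k × (E k →L[ℝ] ℝ) :=
    fun P => (bar V x P, fderiv ℝ (fun x' => bar S x' P) x)
  have hxA : A ∈ 𝓝 x := mem_interior_iff_mem_nhds.1 hx
  have hC : Convex ℝ (Φ '' 𝓕) := by
    rintro _ ⟨P, hP, rfl⟩ _ ⟨Q, hQ, rfl⟩ a b ha hb hab
    lift a to ℝ≥0 using ha
    lift b to ℝ≥0 using hb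
    obtain ⟨R, hR, hRe⟩ := h𝓕 (mem_image_of_mem _ hP) (mem_image_of_mem _ hQ)
      zero_le zero_le (by exact_mod_cast hab)
    refine ⟨R, hR, ?_⟩
    have h1 := bar_eq_of_mixture (hV.2.1 x (interior_subset hx)) hP hQ hRe
    -- Integrability of the score is known only on `A`, so the mixture identity holds near `x`,
    -- which suffices for differentiating.
    have h2 : (fun x' => bar S x' R) =ᶠ[𝓝 x]
        fun x' => (a : ℝ) • bar S x' P + (b : ℝ) • bar S x' Q := by
      filter_upwards [hxA] with x' hx'
      exact bar_eq_of_mixture (hS.1 x' hx') hP hQ hRe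
    have h3 := (((differentiableAt_bar hS1 hx hP).hasFDerivAt.const_smul (a : ℝ)).add
      ((differentiableAt_bar hS1 hx hQ).hasFDerivAt.const_smul (b : ℝ))).congr_of_eventuallyEq h2
    exact Prod.ext h1 h3.fderiv
  have h0 : ∀ s, ((0 : E k), s) ∈ Φ '' 𝓕 → s = 0 := by
    rintro s ⟨P, hP, hs⟩
    obtain ⟨h1, rfl⟩ := Prod.mk.inj hs
    have hxT := (hV.2.2 x (interior_subset hx) P hP).1 h1
    have hmin : IsLocalMin (fun x' => bar S x' P) x := by
      filter_upwards [hxA] with x' hx'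
      rw [hxT]
      exact hS.2.1 x' hx' P hP
    exact hmin.fderiv_eq_zero
  have hfst : Prod.fst '' (Φ '' 𝓕) = (fun P => bar V x P) '' 𝓕 := by
    rw [image_image]
  have hconv : Convex ℝ ((fun P => bar V x P) '' 𝓕) := by
    rw [← hfst]
    exact hC.linear_image (LinearMap.fst ℝ (E k) (E k →L[ℝ] ℝ))
  have hint : (0 : E k) ∈ interior (Prod.fst '' (Φ '' 𝓕)) := by
    rw [hfst]
    obtain ⟨P, hP, h1⟩ := hV1 x hx
    refine interior_mono (convexHull_min ?_ hconv) h1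
    rintro _ ⟨i, rfl⟩
    exact mem_image_of_mem _ (hP i)
  obtain ⟨f, hf⟩ := exists_linearMap_of_convex hC h0 hint
  exact ⟨f, fun P hP => hf _ (mem_image_of_mem Φ hP)⟩

lemma exists_osbandRelation
    (h𝓕 : Convex ℝ≥0 ((fun P : ProbabilityMeasure O => (P : Measure O)) '' 𝓕))
    (hV : IsStrictIdentification A 𝓕 T V) (hS : IsStrictlyConsistent A 𝓕 T S)
    (hV1 : CondV1 A 𝓕 V) (hS1 : CondS1 A 𝓕 S) :
    ∃ h : E k → Matrix (Fin k) (Fin k) ℝ, OsbandRelation A 𝓕 V S h := by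
  choose! f hf using fun x (hx : x ∈ interior A) =>
    exists_linearMap_bar_eq_fderiv h𝓕 hV hS hV1 hS1 hx
  refine ⟨fun x => Matrix.of fun l m => f x (EuclideanSpace.single m 1)
    (EuclideanSpace.single l 1), fun x hx P hP l => ?_⟩
  have h1 := (differentiableAt_bar hS1 hx hP).hasFDerivAt.hasLineDerivAt
    (EuclideanSpace.single l (1 : ℝ))
  rw [← hf x hx P hP] at h1
  have h2 : bar V x P = ∑ m, bar V x P m • EuclideanSpace.single m (1 : ℝ) := by
    simpa using ((EuclideanSpace.basisFun (Fin k) ℝ).sum_repr (bar V x P)).symm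
  have h3 : f x (bar V x P) (EuclideanSpace.single l 1) = ∑ m,
      f x (EuclideanSpace.single m 1) (EuclideanSpace.single l 1) * bar V x P m := by
    conv_lhs => rw [h2]
    simp [mul_comm]
  rwa [h3] at h1

lemma OsbandRelation.sum_eq_fderiv (hh : OsbandRelation A 𝓕 V S h) (hS1 : CondS1 A 𝓕 S) {x : E k}
    (hx : x ∈ interior A) {P : ProbabilityMeasure O} (hP : P ∈ 𝓕) (l : Fin k) :
    ∑ m, h x l m * bar V x P m =
      fderiv ℝ (fun x' => bar S x' P) x (EuclideanSpace.single l 1) :=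
  (hh x hx P hP l).unique ((differentiableAt_bar hS1 hx hP).hasFDerivAt.hasLineDerivAt _)

/-- The matrix with rows `V̄(x, Qⱼ)`. -/
noncomputable def barMatrix (V : E k → O → E k) (Q : Fin k → ProbabilityMeasure O) (x : E k) :
    Matrix (Fin k) (Fin k) ℝ :=
  Matrix.of fun j m => bar V x (Q j) m

/-- A subspace with an interior point is everything, so by (V1) the vectors V̄(x,Pᵢ) span and
contain a basis. -/
lemma exists_isUnit_barMatrix (hV1 : CondV1 A 𝓕 V) {x : E k} (hx : x ∈ interior A) :
    ∃ Q : Fin k → ProbabilityMeasure O, (∀ j, Q j ∈ 𝓕) ∧ IsUnit (barMatrix V Q x) := by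
  obtain ⟨P, hP, h0⟩ := hV1 x hx
  set s := range fun i => bar V x (P i)
  have hspan : Submodule.span ℝ s = ⊤ := by
    refine Submodule.eq_top_of_nonempty_interior' _ ⟨0, interior_mono ?_ h0⟩
    exact convexHull_min Submodule.subset_span (Submodule.convex _)
  obtain ⟨f, hfs, -, hli⟩ := Submodule.exists_fun_fin_finrank_span_eq ℝ s
  have hk : k = Module.finrank ℝ (Submodule.span ℝ s) := by
    rw [hspan, finrank_top, finrank_euclideanSpace_fin]
  choose i hi using hfs
  refine ⟨fun j => P (i (Fin.cast hk j)), fun j => hP _, ?_⟩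
  rw [← Matrix.linearIndependent_rows_iff_isUnit]
  have h1 : LinearIndependent ℝ fun j : Fin k => f (Fin.cast hk j) :=
    hli.comp _ (Fin.cast_injective hk)
  have h2 := h1.map' (WithLp.linearEquiv 2 ℝ (Fin k → ℝ)).toLinearMap (LinearEquiv.ker _)
  have h3 : (barMatrix V (fun j => P (i (Fin.cast hk j))) x).row =
      (WithLp.linearEquiv 2 ℝ (Fin k → ℝ)).toLinearMap ∘ fun j : Fin k => f (Fin.cast hk j) := by
    funext j m
    simp only [Function.comp, ← hi]
    rfl
  rw [h3]
  exact h2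

lemma OsbandRelation.barMatrix_mul_transpose (hh : OsbandRelation A 𝓕 V S h) (hS1 : CondS1 A 𝓕 S)
    {x : E k} (hx : x ∈ interior A) {Q : Fin k → ProbabilityMeasure O} (hQ : ∀ j, Q j ∈ 𝓕) :
    barMatrix V Q x * (h x).transpose = Matrix.of fun j l =>
      fderiv ℝ (fun x' => bar S x' (Q j)) x (EuclideanSpace.single l 1) := by
  ext j l
  rw [Matrix.of_apply, ← hh.sum_eq_fderiv hS1 hx (hQ j) l, Matrix.mul_apply]
  simp [barMatrix, mul_comm]

lemma OsbandRelation.eqOn {h' : E k → Matrix (Fin k) (Fin k) ℝ} (hh : OsbandRelation A 𝓕 V S h)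
    (hh' : OsbandRelation A 𝓕 V S h') (hV1 : CondV1 A 𝓕 V) (hS1 : CondS1 A 𝓕 S) :
    EqOn h' h (interior A) := by
  intro x hx
  obtain ⟨Q, hQ, hu⟩ := exists_isUnit_barMatrix hV1 hx
  have h1 := (hh'.barMatrix_mul_transpose hS1 hx hQ).trans
    (hh.barMatrix_mul_transpose hS1 hx hQ).symm
  exact Matrix.transpose_injective (hu.mul_left_cancel h1)

/-- With `Q` fixed, `barMatrix V Q` stays invertible near `x`. There `h` is the transpose of its
inverse times the matrix of gradients, and both factors are continuous by (V2) and (S1). -/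
lemma OsbandRelation.continuousOn (hh : OsbandRelation A 𝓕 V S h) (hV1 : CondV1 A 𝓕 V)
    (hV2 : CondV2 A 𝓕 V) (hS1 : CondS1 A 𝓕 S) : ContinuousOn h (interior A) := by
  intro x hx
  apply ContinuousAt.continuousWithinAt
  obtain ⟨Q, hQ, hu⟩ := exists_isUnit_barMatrix hV1 hx
  have hB : ContinuousAt (barMatrix V Q) x := by
    refine continuousAt_pi.2 fun j => continuousAt_pi.2 fun m => ?_
    have h1 := (hV2 (Q j) (hQ j)).continuousAt (mem_interior_iff_mem_nhds.1 hx)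
    exact (continuous_coord m).continuousAt.comp h1
  have hD : ContinuousAt (fun x => (Matrix.of fun j l =>
      fderiv ℝ (fun x' => bar S x' (Q j)) x (EuclideanSpace.single l 1) :
        Matrix (Fin k) (Fin k) ℝ)) x := by
    refine continuousAt_pi.2 fun j => continuousAt_pi.2 fun l => ?_
    have h1 := ((hS1 (Q j) (hQ j)).continuousOn_fderiv_of_isOpen isOpen_interior
      le_rfl).continuousAt (isOpen_interior.mem_nhds hx)
    exact h1.clm_apply continuousAt_const
  have hdet : (barMatrix V Q x).det ≠ 0 := ((Matrix.isUnit_iff_isUnit_det _).1 hu).ne_zero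
  have hinv : ContinuousAt (fun x => (barMatrix V Q x)⁻¹) x := by
    refine (continuousAt_matrix_inv _ ?_).comp hB
    rw [Ring.inverse_eq_inv']
    exact continuousAt_inv₀ hdet
  have hdet' : ∀ᶠ x' in 𝓝 x, (barMatrix V Q x').det ≠ 0 :=
    (continuous_id.matrix_det.continuousAt.comp hB).eventually_ne hdet
  have hcont : ContinuousAt (fun x => ((barMatrix V Q x)⁻¹ * Matrix.of fun j l =>
      fderiv ℝ (fun x' => bar S x' (Q j)) x (EuclideanSpace.single l 1)).transpose) x :=
    continuous_id.matrix_transpose.continuousAt.comp (hinv.mul hD)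
  refine hcont.congr ?_
  filter_upwards [hdet', isOpen_interior.mem_nhds hx] with x' h1 h2
  rw [← hh.barMatrix_mul_transpose hS1 h2 hQ,
    Matrix.nonsing_inv_mul_cancel_left _ _ h1.isUnit, Matrix.transpose_transpose]

/-! ### Representation along the path -/

section path

variable {x z : E k}

lemma continuousOn_comp_pathPoint {G : Type*} [TopologicalSpace G] {g : E k → G}
    (hA : IsHyperrectangle (interior A)) (hx : x ∈ interior A) (hz : z ∈ interior A)
    (hg : ContinuousOn g (interior A)) (r : Fin k) :
    ContinuousOn (fun v => g (pathPoint x z r v)) (uIcc (z r) (x r)) :=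
  hg.comp (continuous_pathPoint x z r).continuousOn fun _ hv => hA.pathPoint_mem hx hz r hv

lemma continuousOn_mul_bar (hA : IsHyperrectangle (interior A)) (hx : x ∈ interior A)
    (hz : z ∈ interior A) (hh : ContinuousOn h (interior A)) (hV2 : CondV2 A 𝓕 V)
    {P : ProbabilityMeasure O} (hP : P ∈ 𝓕) (r m : Fin k) :
    ContinuousOn (fun v => h (pathPoint x z r v) r m * bar V (pathPoint x z r v) P m)
      (uIcc (z r) (x r)) := by
  refine ContinuousOn.mul ?_ ?_
  · exact continuousOn_comp_pathPoint (g := fun u => h u r m) hA hx hz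
      (continuousOn_pi.1 (continuousOn_pi.1 hh r) m) r
  · refine continuousOn_comp_pathPoint (g := fun u => bar V u P m) hA hx hz ?_ r
    exact (continuous_coord m).comp_continuousOn
      ((hV2 P hP).mono interior_subset)

/-- The expected score is obtained by integrating along the axis-parallel path. -/
lemma OsbandRelation.bar_eq (hh : OsbandRelation A 𝓕 V S h) (hA : IsHyperrectangle (interior A))
    (hx : x ∈ interior A) (hz : z ∈ interior A) (hhc : ContinuousOn h (interior A))
    (hV2 : CondV2 A 𝓕 V) {P : ProbabilityMeasure O} (hP : P ∈ 𝓕) :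
    bar S x P = (∑ r : Fin k, ∑ m : Fin k, ∫ v in (z r)..(x r),
      h (pathPoint x z r v) r m * bar V (pathPoint x z r v) P m) + bar S z P := by
  have hc := continuousOn_mul_bar hA hx hz hhc hV2 hP
  rw [← sub_eq_iff_eq_add]
  rw [sub_eq_sum_integral_pathPoint (f := fun u => bar S u P)
    (g := fun r u => ∑ m, h u r m * bar V u P m)
    (fun r v hv => hh _ (hA.pathPoint_mem hx hz r hv) P hP r)
    (fun r => (continuousOn_finsetSum _ fun m _ => hc r m).intervalIntegrable)]
  exact Finset.sum_congr rfl fun r _ =>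
    intervalIntegral.integral_finsetSum fun m _ => (hc r m).intervalIntegrable

/-- The product of a leg of the path with `K` is compact in `A × O`, so (B1) applies. The bound
serves for dominated convergence and, with `K` a singleton, for integrability of the line
integrands. -/
lemma exists_norm_pathPoint_le (hA : IsHyperrectangle (interior A)) (hx : x ∈ interior A)
    (hz : z ∈ interior A) (hB1 : CondB1 A V) {K : Set O} (hK : IsCompact K) (r : Fin k) :
    ∃ M : ℝ, ∀ v ∈ uIcc (z r) (x r), ∀ y ∈ K, ‖V (pathPoint x z r v) y‖ ≤ M := by
  have hsub : pathPoint x z r '' uIcc (z r) (x r) ⊆ A := by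
    rintro _ ⟨v, hv, rfl⟩
    exact interior_subset (hA.pathPoint_mem hx hz r hv)
  have h1 : IsCompact ((Subtype.val : A → E k) ⁻¹' (pathPoint x z r '' uIcc (z r) (x r))) := by
    rw [Topology.IsInducing.subtypeVal.isCompact_preimage_iff (by simpa using hsub)]
    exact isCompact_uIcc.image (continuous_pathPoint x z r)
  obtain ⟨M, hM⟩ := hB1 _ (h1.prod hK)
  exact ⟨M, fun v hv y hy =>
    hM (⟨pathPoint x z r v, hsub (mem_image_of_mem _ hv)⟩, y) ⟨mem_image_of_mem _ hv, hy⟩⟩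

lemma intervalIntegrable_mul_pathPoint (hA : IsHyperrectangle (interior A)) (hx : x ∈ interior A)
    (hz : z ∈ interior A) (hh : ContinuousOn h (interior A)) (hB1 : CondB1 A V)
    (hV : Measurable fun p : A × O => V p.1 p.2) (y : O) (r m : Fin k) :
    IntervalIntegrable (fun v => h (pathPoint x z r v) r m * V (pathPoint x z r v) y m)
      volume (z r) (x r) := by
  refine IntervalIntegrable.continuousOn_mul ?_
    (continuousOn_comp_pathPoint (g := fun u => h u r m) hA hx hz
      (continuousOn_pi.1 (continuousOn_pi.1 hh r) m) r)
  obtain ⟨M, hM⟩ := exists_norm_pathPoint_le hA hx hz hB1 (isCompact_singleton (x := y)) r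
  have hmeas : AEMeasurable (fun v => V (pathPoint x z r v) y m)
      (volume.restrict (uIcc (z r) (x r))) := by
    refine aemeasurable_restrict_of_measurable_subtype measurableSet_uIcc ?_
    have h1 : Measurable fun v : uIcc (z r) (x r) =>
        ((⟨pathPoint x z r v, interior_subset (hA.pathPoint_mem hx hz r v.2)⟩, y) : A × O) :=
      (((continuous_pathPoint x z r).measurable.comp measurable_subtype_coe).subtype_mk).prodMk
        measurable_const
    exact (continuous_coord m).measurable.comp
      (hV.comp h1)
  rw [intervalIntegrable_iff]
  refine IntegrableOn.mono_set ?_ uIoc_subset_uIcc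
  have : IsFiniteMeasure (volume.restrict (uIcc (z r) (x r))) :=
    ⟨by simp⟩
  refine Integrable.of_bound hmeas.aestronglyMeasurable M ?_
  filter_upwards [ae_restrict_mem measurableSet_uIcc] with v hv
  exact (PiLp.norm_apply_le _ m).trans (hM v hv y rfl)

/-- The pointwise representation, at an observation where the score and the identification function
are continuous (almost everywhere along the path). -/
lemma OsbandRelation.score_eq (hh : OsbandRelation A 𝓕 V S h) (hA : IsHyperrectangle (interior A))
    (hx : x ∈ interior A) (hz : z ∈ interior A) (hhc : ContinuousOn h (interior A))
    (hV : IsStrictIdentification A 𝓕 T V) (hS : IsStrictlyConsistent A 𝓕 T S)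
    (hV2 : CondV2 A 𝓕 V) (hF1 : CondF1 𝓕) (hB1 : CondB1 A V)
    (hSb : ∀ x ∈ A, LocallyBdd (S x)) {y : O}
    (hSx : ContinuousAt (S x) y) (hSz : ContinuousAt (S z) y)
    (hVc : ∀ r, ∀ᵐ v : ℝ, v ∈ uIcc (z r) (x r) → ContinuousAt (V (pathPoint x z r v)) y) :
    S x y = (∑ r : Fin k, ∑ m : Fin k, ∫ v in (z r)..(x r),
      h (pathPoint x z r v) r m * V (pathPoint x z r v) y m) + S z y := by
  obtain ⟨P, K, hP, hK, hPK, hlim⟩ := hF1 y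
  have hSlim : ∀ u ∈ interior A, ContinuousAt (S u) y →
      Tendsto (fun n => bar S u (P n)) atTop (𝓝 (S u y)) := by
    intro u hu hc
    obtain ⟨M, hM⟩ := hSb u (interior_subset hu) K hK
    exact tendsto_integral_of_tendsto_dirac hlim hPK hc
      (fun n => hS.1 u (interior_subset hu) _ (hP n)) hM
  -- Both sides of `bar_eq` for `P n` are compared in the limit: the scores converge by continuity
  -- at `y`, the line integrals by dominated convergence.
  refine tendsto_nhds_unique (hSlim x hx hSx) ?_
  simp_rw [fun n => hh.bar_eq hA hx hz hhc hV2 (hP n)]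
  refine Tendsto.add (tendsto_finsetSum _ fun r _ => tendsto_finsetSum _ fun m _ => ?_)
    (hSlim z hz hSz)
  obtain ⟨M, hM⟩ := exists_norm_pathPoint_le hA hx hz hB1 hK r
  have hhr : ContinuousOn (fun v => h (pathPoint x z r v) r m) (uIcc (z r) (x r)) :=
    continuousOn_comp_pathPoint (g := fun u => h u r m) hA hx hz
      (continuousOn_pi.1 (continuousOn_pi.1 hhc r) m) r
  have hc := fun n => continuousOn_mul_bar hA hx hz hhc hV2 (hP n) r m
  refine intervalIntegral.tendsto_integral_filter_of_dominated_convergence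
    (fun v => ‖h (pathPoint x z r v) r m‖ * M) ?_ ?_ ?_ ?_
  · exact Eventually.of_forall fun n =>
      (intervalIntegrable_iff.1 (hc n).intervalIntegrable).aestronglyMeasurable
  · refine Eventually.of_forall fun n => Eventually.of_forall fun v hv => ?_
    rw [norm_mul]
    refine mul_le_mul_of_nonneg_left ((PiLp.norm_apply_le _ m).trans ?_) (norm_nonneg _)
    have hKae : ∀ᵐ y' ∂(P n : Measure O), ‖V (pathPoint x z r v) y'‖ ≤ M := by
      have : ∀ᵐ y' ∂(P n : Measure O), y' ∈ K := by
        rw [ae_iff]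
        exact hPK n
      filter_upwards [this] with y' hy'
      exact hM v (uIoc_subset_uIcc hv) y' hy'
    simpa [bar] using norm_integral_le_of_norm_le_const hKae
  · exact (hhr.norm.mul continuousOn_const).intervalIntegrable
  · filter_upwards [hVc r] with v hv hvm
    have hv' := uIoc_subset_uIcc hvm
    have h1 : Tendsto (fun n => bar V (pathPoint x z r v) (P n)) atTop
        (𝓝 (V (pathPoint x z r v) y)) :=
      tendsto_integral_of_tendsto_dirac hlim hPK (hv hv')
        (fun n => hV.2.1 _ (interior_subset (hA.pathPoint_mem hx hz r hv')) _ (hP n)) (hM v hv')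
    exact (((continuous_coord m).tendsto _).comp
      h1).const_mul _

end path

end Osband

/-! ### The representation theorem -/

theorem mainTheorem1 {k d : ℕ} (A : Set (Osband.E k)) (O : Set (Osband.E d))
    (𝓕 : Set (ProbabilityMeasure O))
    (h𝓕 : Convex ℝ≥0 ((fun P : ProbabilityMeasure O => (P : Measure O)) '' 𝓕))
    (hA : Osband.IsHyperrectangle (interior A))
    (T : ProbabilityMeasure O → Osband.E k) (hT : T '' 𝓕 = A)
    (V : Osband.E k → O → Osband.E k) (S : Osband.E k → O → ℝ)
    (hV : Osband.IsStrictIdentification A 𝓕 T V)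
    (hS : Osband.IsStrictlyConsistent A 𝓕 T S)
    (hV1 : Osband.CondV1 A 𝓕 V) (hV2 : Osband.CondV2 A 𝓕 V) (hS1 : Osband.CondS1 A 𝓕 S)
    (hF1 : Osband.CondF1 𝓕) (hVS1 : Osband.CondVS1 A V S) (hB1 : Osband.CondB1 A V)
    (hloc : Osband.LocalRegularity A V S) :
    ∃ h : Osband.E k → Matrix (Fin k) (Fin k) ℝ,
      -- `h` is the matrix-valued function of the first Osband principle, unique on `int A`
      Osband.OsbandRelation A 𝓕 V S h ∧
      (∀ h' : Osband.E k → Matrix (Fin k) (Fin k) ℝ,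
        Osband.OsbandRelation A 𝓕 V S h' → EqOn h' h (interior A)) ∧
      ContinuousOn h (interior A) ∧
      -- all line integrals below exist
      (∀ z ∈ interior A, ∀ x ∈ interior A, ∀ r m : Fin k,
        (∀ y : O, IntervalIntegrable
          (fun v => h (Osband.pathPoint x z r v) r m * V (Osband.pathPoint x z r v) y m)
          volume (z r) (x r)) ∧
        (∀ P ∈ 𝓕, IntervalIntegrable
          (fun v => h (Osband.pathPoint x z r v) r m *
            Osband.bar V (Osband.pathPoint x z r v) P m)
          volume (z r) (x r))) ∧
      -- the representation, for almost every base point `z ∈ int A`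
      (∀ᵐ z : Osband.E k, z ∈ interior A →
        ∃ a : O → ℝ, Osband.ClassIntegrable 𝓕 a ∧
          (∀ᵐ p : Osband.E k × Osband.E d, p.1 ∈ interior A → ∀ hy : p.2 ∈ O,
            S p.1 ⟨p.2, hy⟩ =
              (∑ r : Fin k, ∑ m : Fin k, ∫ v in (z r)..(p.1 r),
                h (Osband.pathPoint p.1 z r v) r m *
                  V (Osband.pathPoint p.1 z r v) ⟨p.2, hy⟩ m) + a ⟨p.2, hy⟩) ∧
          (∀ x ∈ interior A, ∀ P ∈ 𝓕,
            Osband.bar S x P =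
              (∑ r : Fin k, ∑ m : Fin k, ∫ v in (z r)..(x r),
                h (Osband.pathPoint x z r v) r m *
                  Osband.bar V (Osband.pathPoint x z r v) P m) +
                ∫ y, a y ∂(P : Measure O))) := by
  obtain ⟨h, hh⟩ := Osband.exists_osbandRelation h𝓕 hV hS hV1 hS1
  have hhc := hh.continuousOn hV1 hV2 hS1
  refine ⟨h, hh, fun h' hh' => hh.eqOn hh' hV1 hS1, hhc, fun z hz x hx r m =>
    ⟨fun y => Osband.intervalIntegrable_mul_pathPoint hA hx hz hhc hB1 hV.1 y r m, fun P hP =>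
      (Osband.continuousOn_mul_bar hA hx hz hhc hV2 hP r m).intervalIntegrable⟩, ?_⟩
  have hN : ∀ᵐ q : Osband.E k × Osband.E d, q ∉ {p : Osband.E k × Osband.E d | p.1 ∈ A ∧
      ∃ hy : p.2 ∈ O, ¬ (ContinuousAt (V p.1) ⟨p.2, hy⟩ ∧ ContinuousAt (S p.1) ⟨p.2, hy⟩)} := by
    exact measure_eq_zero_iff_ae_notMem.1 hVS1
  have hcont : ∀ q : Osband.E k × Osband.E d, q ∉ {p : Osband.E k × Osband.E d | p.1 ∈ A ∧
      ∃ hy : p.2 ∈ O, ¬ (ContinuousAt (V p.1) ⟨p.2, hy⟩ ∧ ContinuousAt (S p.1) ⟨p.2, hy⟩)} →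
      q.1 ∈ interior A → ∀ hy : q.2 ∈ O,
        ContinuousAt (V q.1) ⟨q.2, hy⟩ ∧ ContinuousAt (S q.1) ⟨q.2, hy⟩ := by
    intro q hq hqA hy
    by_contra hc
    exact hq ⟨interior_subset hqA, hy, hc⟩
  filter_upwards [Osband.ae_pathPoint_notMem hVS1, Measure.ae_ae_of_ae_prod hN] with z h1 h2 hz
  -- At `x = z` every line integral vanishes, which suggests `a = S z`.
  refine ⟨S z, hS.1 z (interior_subset hz), ?_,
    fun x hx P hP => hh.bar_eq hA hx hz hhc hV2 hP⟩
  -- For this `z`, the bad observations `y` are null; pulling back along the projection makes them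
  -- null among pairs `(x, y)`.
  have h3 : ∀ᵐ p : Osband.E k × Osband.E d, (z, p.2) ∉ {p : Osband.E k × Osband.E d | p.1 ∈ A ∧
      ∃ hy : p.2 ∈ O, ¬ (ContinuousAt (V p.1) ⟨p.2, hy⟩ ∧ ContinuousAt (S p.1) ⟨p.2, hy⟩)} :=
    Measure.quasiMeasurePreserving_snd.ae h2
  filter_upwards [h1, h3, hN] with p hp1 hp2 hp3 hpA hy
  refine hh.score_eq hA hpA hz hhc hV hS hV2 hF1 hB1 (fun x hx => (hloc.1 x hx).2)
    (hcont p hp3 hpA hy).2 (hcont (z, p.2) hp2 hz hy).2 fun r => ?_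
  filter_upwards [hp1 r] with v hv hvm
  exact (hcont (Osband.pathPoint p.1 z r v, p.2) hv (hA.pathPoint_mem hpA hz r hvm) hy).1
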